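/- Let $n\ge 1$ and let $N$ (impressions) and $V$ (ads) be finite sets with $|N|=|V|=n$. Write $[k]=\{1,\dots,k\}$. Consider the online bipartite matching process with $n$ stages counted down from $n$ to $1$: in each stage an impression drawn independently and uniformly from $N$ appears and is irrevocably either matched to a still available ad of $V$ or discarded. Let $Q\subseteq\mathbb{R}^{N\times V\times[n]}$ be the polyhedron of achievable matching probabilities, i.e. the set of all $z=(z_{ij}^t)$ for which there are $x_{i,j}^{t,S}\ge 0$ ($i\in N$, $j\in V$, $t\in[n]$, $S\subseteq V\setminus\{j\}$; the probability of matching $i$ to $j$ in stage $t$ when $S\cup\{j\}$ is the set of available ads) and $y_i^{t,S}\ge 0$ ($i\in N$, $t\in[n]$, $S\subseteq V$; the probability of discarding $i$ in stage $t$ when $S$ is the set of available ads), with $x_{i,j}^{t,S}=0$ whenever $|S|+1<t$ (such states are never reached), such that $z_{ij}^t=\sum_{S\subseteq V\setminus\{j\}}x_{i,j}^{t,S}$ for all $i,j,t$ and $$\sum_{j\in V}x_{i,j}^{n,V\setminus\{j\}}+y_i^{n,V}\le\tfrac1n\qquad(i\in N),$$ $$\sum_{j\in S}x_{i,j}^{t,S\setminus\{j\}}+1_{\{t\ne1\}}\,y_i^{t,S}-\tfrac1n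 1_{\{|S|>t\}}\sum_{k\in N}y_k^{t+1,S}-\tfrac1n\sum_{k\in N}\sum_{j\in V\setminus S}x_{k,j}^{t+1,S}\le 0\qquad(t\in[n-1],\ i\in N,\ \emptyset\ne S\subsetneq V,\ |S|\ge t),$$ $$\sum_{j\in V}x_{i,j}^{t,V\setminus\{j\}}+1_{\{t\ne1\}}\,y_i^{t,V}-\tfrac1n\sum_{k\in N}y_k^{t+1,V}\le 0\qquad(t\in[n-1],\ i\in N).$$ For $I\subseteq N$, $J\subseteq V$ and $t\in[n]$ put $Z_{I,J}^t=\sum_{i\in I}\sum_{j\in J}z_{ij}^t$, and write $Z_{i,J}^t$ for $Z_{\{i\},J}^t$. **Theorem.** For every $J\subseteq V$ with $|J|=h\in[n-1]$, every $t\in[n-h]$ and all impressions $i_t,\dots,i_{t+h-1}\in N$ (repetitions allowed), the inequality $$\sum_{\tau=t+h}^{n}Z_{N,J}^{\tau}+\sum_{\tau=t}^{t+h-1}n^{t+h-\tau}Z_{i_\tau,J}^{\tau}\le 1+\sum_{\tau=1}^{h-1}n^{\tau}$$ is facet-defining for $Q$: it is valid for every $z\in Q$, and the set of points of $Q$ that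 satisfy it with equality is nonempty and has affine dimension $\dim Q-1$. -/

import Mathlib

/-- The stages `1, …, n`, counted down: in stage `t`, exactly `t` decision epochs (including the
current one) remain, so the process starts in stage `n` and ends in stage `1`. -/
abbrev Stage (n : ℕ) : Type := {t : ℕ // t ∈ Finset.Icc 1 n}

/-- The constraints of the primal linear program of the online bipartite matching model with
impressions `N`, ads `V` and `n` stages.  The variable `x t i j S` (for `j ∉ S`) is the probability
that the policy matches impression `i` to ad `j` in stage `t` in the state in which the set of
available ads is `S ∪ {j}`; the variable `y t i S` is the probability that the policy discards
impression `i` in stage `t` when the set of available ads is `S`.  Stages are written as natural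
numbers; only the values `1 ≤ t ≤ n` enter. -/
structure PolicyFeasible {N V : Type*} [Fintype N] [Fintype V] [DecidableEq V] (n : ℕ)
    (x : ℕ → N → V → Finset V → ℝ) (y : ℕ → N → Finset V → ℝ) : Prop where
  x_nonneg : ∀ t i j S, 0 ≤ x t i j S
  y_nonneg : ∀ t i S, 0 ≤ y t i S
  /-- At most `n - t` ads have been used before stage `t`, so a state with fewer than `t` available
  ads (here `S ∪ {j}`) does not occur and carries no matching probability. -/
  unreachable : ∀ t ∈ Finset.Icc 1 n, ∀ (i : N) (j : V) (S : Finset V),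
    j ∉ S → S.card + 1 < t → x t i j S = 0
  /-- First epoch: all ads are available and each impression appears with probability `1 / n`. -/
  initial : ∀ i : N,
    ∑ j : V, x n i j (Finset.univ.erase j) + y n i Finset.univ ≤ 1 / (n : ℝ)
  /-- Later epochs, some but not all ads are available. -/
  flow : ∀ t ∈ Finset.Icc 1 (n - 1), ∀ (i : N) (S : Finset V),
    S.Nonempty → S ≠ Finset.univ → t ≤ S.card →
    ∑ j ∈ S, x t i j (S.erase j) + (if t ≠ 1 then y t i S else 0)
      - 1 / (n : ℝ) * (if t < S.card then ∑ k : N, y (t + 1) k S else 0)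
      - 1 / (n : ℝ) * ∑ k : N, ∑ j ∈ Sᶜ, x (t + 1) k j S ≤ 0
  /-- Later epochs, all ads are still available. -/
  flow_univ : ∀ t ∈ Finset.Icc 1 (n - 1), ∀ i : N,
    ∑ j : V, x t i j (Finset.univ.erase j) + (if t ≠ 1 then y t i Finset.univ else 0)
      - 1 / (n : ℝ) * ∑ k : N, y (t + 1) k Finset.univ ≤ 0

/-- The polyhedron `Q` of achievable time-indexed matching probabilities: the projection of the
feasible region of the linear program to the variables `z i j t`, the probability that impression
`i` is matched to ad `j` in stage `t`. -/
def achievable (N V : Type*) [Fintype N] [Fintype V] [DecidableEq V] (n : ℕ) :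
    Set (N → V → Stage n → ℝ) :=
  {z | ∃ (x : ℕ → N → V → Finset V → ℝ) (y : ℕ → N → Finset V → ℝ),
    PolicyFeasible n x y ∧
      ∀ (i : N) (j : V) (t : Stage n),
        z i j t = ∑ S ∈ (Finset.univ.erase j).powerset, x t i j S}

/-- `aggr z I J t` is `Z_{I,J}^t`, the sum of `z_{ij}^t` over `i ∈ I` and `j ∈ J`. -/
def aggr {N V : Type*} {n : ℕ} (z : N → V → Stage n → ℝ) (I : Finset N) (J : Finset V)
    (t : Stage n) : ℝ :=
  ∑ i ∈ I, ∑ j ∈ J, z i j t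

/-- The left-hand side of the inequality, as a linear functional of `z`:
`∑_{τ = t+h}^{n} Z_{N,J}^τ + ∑_{τ = t}^{t+h-1} n^{t+h-τ} Z_{i_τ,J}^τ`.
Only the impressions `imp τ` with `t ≤ τ < t + h` enter. -/
def jSizeLhs {N V : Type*} [Fintype N] (n : ℕ) (J : Finset V) (h t : ℕ) (imp : Stage n → N) :
    (N → V → Stage n → ℝ) →ₗ[ℝ] ℝ where
  toFun z :=
    ∑ τ ∈ Finset.univ.filter (fun τ : Stage n => t + h ≤ τ.1), aggr z Finset.univ J τ
      + ∑ τ ∈ Finset.univ.filter (fun τ : Stage n => t ≤ τ.1 ∧ τ.1 < t + h),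
          (n : ℝ) ^ (t + h - τ.1) * aggr z {imp τ} J τ
  map_add' z w := by
    simp only [aggr, Pi.add_apply, Finset.sum_add_distrib, mul_add]
    ring
  map_smul' c z := by
    simp only [aggr, Pi.smul_apply, smul_eq_mul, RingHom.id_apply, mul_add, Finset.mul_sum,
      mul_left_comm]

/-- The inequality `f z ≤ b` is facet-defining for `P`: it is valid for `P`, and the face
`{z ∈ P | f z = b}` is nonempty and has (affine) dimension exactly one less than that of `P`. -/
structure IsFacetDefining {E : Type*} [AddCommGroup E] [Module ℝ E] [FiniteDimensional ℝ E]
    (P : Set E) (f : E →ₗ[ℝ] ℝ) (b : ℝ) : Prop where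
  valid : ∀ z ∈ P, f z ≤ b
  face_nonempty : {z ∈ P | f z = b}.Nonempty
  dim_face : Module.finrank ℝ (vectorSpan ℝ {z ∈ P | f z = b}) + 1 =
    Module.finrank ℝ (vectorSpan ℝ P)

/-! Validity is linear programming duality in the form of dynamic programming. Read the left-hand
side as a reward. In a stage `τ` with `t ≤ τ < t + h`, matching the distinguished impression `ι τ`
to `J` pays `n ^ (t + h - τ)`. That impression appears with probability `1 / n`, so waiting for it
is worth `n ^ (t + h - 1 - τ)`. These values are `1, n, …, n ^ (h - 1)`, growing towards the end of
the process. With `k` ads of `J` left it is best to reserve one for each of the stages `t, …, t + k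
- 1`. The resulting optimal value is `potential`, and at the start it equals the right-hand side.
The one-step inequalities are `potential_le_impressionValue` and `coeff_add_potential_le`;
`reward_le_of_dominating` sums them over all states.

For the dimension, every policy that uses only optimal actions gives a point of the face
(`policyPoint_mem_face`). The weights create many ties between optimal actions. Two optimal policies
that differ in one action, in one reachable state, agree in all earlier epochs. If a functional is
constant on the face and ignores all later epochs, it must therefore give both actions the same
coefficient (`actionReward_eq_of_optimal`). Induction from stage 1 upwards then kills every
coefficient except those of `ι t` on `J` in stage `t`, and these are all equal
(`eq_zero_of_constant_on_face`). Hence the face has codimension at most one. It is a proper face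
because the origin is achievable and the right-hand side is nonzero. -/

noncomputable section

namespace OnlineMatching

open Finset

/-! ### Weak duality for the linear program. -/

section Telescoping

variable {N V : Type*} [Fintype N] [Fintype V] [DecidableEq V]

/-- The probability of reaching stage `t` with set `S` of available ads, read off from the decisions
in stage `t + 1`. -/
def inflow (n : ℕ) (x : ℕ → N → V → Finset V → ℝ) (y : ℕ → N → Finset V → ℝ) (t : ℕ)
    (S : Finset V) : ℝ :=
  if t = n then (if S = univ then 1 else 0)
  else (if t < S.card then ∑ k : N, y (t + 1) k S else 0)
    + ∑ k : N, ∑ j ∈ Sᶜ, x (t + 1) k j S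

theorem sum_erase_eq_sum_compl (m : ℕ) (F : V → Finset V → ℝ) :
    ∑ S : Finset V with m + 1 ≤ S.card, ∑ j ∈ S, F j (S.erase j)
      = ∑ S : Finset V with m ≤ S.card, ∑ j ∈ Sᶜ, F j S := by
  rw [Finset.sum_sigma', Finset.sum_sigma']
  refine Finset.sum_bij' (fun p _ => ⟨p.1.erase p.2, p.2⟩) (fun p _ => ⟨insert p.2 p.1, p.2⟩)
    ?_ ?_ ?_ ?_ ?_
  · rintro ⟨S, j⟩ hp
    simp only [mem_sigma, mem_filter, mem_univ, true_and, mem_compl] at hp ⊢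
    refine ⟨?_, by simp⟩
    rw [card_erase_of_mem hp.2]
    omega
  · rintro ⟨S, j⟩ hp
    simp only [mem_sigma, mem_filter, mem_univ, true_and, mem_compl] at hp ⊢
    refine ⟨?_, by simp⟩
    rw [card_insert_of_notMem hp.2]
    omega
  · rintro ⟨S, j⟩ hp
    simp only [mem_sigma, mem_filter, mem_univ, true_and] at hp
    simp [insert_erase hp.2]
  · rintro ⟨S, j⟩ hp
    simp only [mem_sigma, mem_filter, mem_univ, true_and, mem_compl] at hp
    simp [erase_insert hp.2]
  · rintro ⟨S, j⟩ _
    rfl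

/-- One step of the telescoping sum: what is collected in stage `m + 1` together with the potential
of the resulting state splits into the reward of that stage and the potential weighted by the inflow
into stage `m`. -/
theorem stage_identity {n : ℕ} {x : ℕ → N → V → Finset V → ℝ} {y : ℕ → N → Finset V → ℝ}
    (hx : ∀ t ∈ Icc 1 n, ∀ (i : N) (j : V) (S : Finset V), j ∉ S → S.card + 1 < t → x t i j S = 0)
    (c : N → V → ℝ) (H : Finset V → ℝ) {m : ℕ} (hm : m < n) :
    ∑ S : Finset V with m + 1 ≤ S.card, ∑ i : N,
        (∑ j ∈ S, x (m + 1) i j (S.erase j) * (c i j + H (S.erase j)) + y (m + 1) i S * H S)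
      = ∑ i : N, ∑ j : V, c i j * ∑ S ∈ (univ.erase j).powerset, x (m + 1) i j S
        + ∑ S : Finset V with m ≤ S.card, inflow n x y m S * H S := by
  have h1 : ∀ i : N, ∑ S : Finset V with m + 1 ≤ S.card,
      ∑ j ∈ S, x (m + 1) i j (S.erase j) * (c i j + H (S.erase j))
      = ∑ j : V, c i j * ∑ S ∈ (univ.erase j).powerset, x (m + 1) i j S
        + ∑ S : Finset V with m ≤ S.card, (∑ j ∈ Sᶜ, x (m + 1) i j S) * H S := by
    intro i
    rw [sum_erase_eq_sum_compl m (fun j S => x (m + 1) i j S * (c i j + H S))]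
    simp only [mul_add, sum_add_distrib, sum_mul]
    congr 1
    rw [Finset.sum_comm' (t' := univ)
      (s' := fun j => univ.filter fun S : Finset V => m ≤ S.card ∧ j ∉ S)
      (by intro S j; simp)]
    refine sum_congr rfl fun j _ => ?_
    rw [mul_sum]
    have hsub : (univ.filter fun S : Finset V => m ≤ S.card ∧ j ∉ S) ⊆ (univ.erase j).powerset := by
      intro S hS
      simp only [mem_filter, mem_univ, true_and] at hS
      rw [mem_powerset]
      intro k hk
      simp only [mem_erase, mem_univ, and_true]
      rintro rfl
      exact hS.2 hk
    rw [← sum_subset hsub]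
    · exact sum_congr rfl fun S _ => mul_comm _ _
    -- The matching probability sums over all `S`; the sets too small to be reached contribute
    -- nothing.
    · intro S hS hS'
      have hj : j ∉ S := fun hj => by simpa using mem_powerset.1 hS hj
      rw [hx (m + 1) (by simp; omega) i j S hj, mul_zero]
      simp only [mem_filter, mem_univ, true_and, not_and, not_not] at hS'
      by_contra hlt
      exact hj (hS' (by omega))
  have h2 : ∑ S : Finset V with m ≤ S.card, inflow n x y m S * H S
      = ∑ S : Finset V with m + 1 ≤ S.card, ∑ i : N, y (m + 1) i S * H S
        + ∑ i : N, ∑ S : Finset V with m ≤ S.card, (∑ j ∈ Sᶜ, x (m + 1) i j S) * H S := by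
    rw [Finset.sum_comm (s := (univ : Finset N))]
    simp only [inflow, if_neg hm.ne, add_mul, sum_add_distrib, sum_mul]
    congr 1
    simp only [ite_mul, zero_mul]
    rw [← sum_filter, filter_filter]
    refine sum_congr ?_ fun S _ => by rw [sum_mul]
    ext S
    simp only [mem_filter, mem_univ, true_and]
    omega
  rw [h2]
  simp only [sum_add_distrib]
  rw [Finset.sum_comm (t := (univ : Finset N)), sum_congr rfl fun i _ => h1 i, sum_add_distrib]
  ring

/-- Weak duality: a potential that dominates the decisions of a feasible solution stage by stage
bounds its total reward. -/
theorem reward_le_potential {n : ℕ} (hn : 0 < n) (hV : Fintype.card V = n)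
    {x : ℕ → N → V → Finset V → ℝ} {y : ℕ → N → Finset V → ℝ}
    (hx : ∀ t ∈ Icc 1 n, ∀ (i : N) (j : V) (S : Finset V), j ∉ S → S.card + 1 < t → x t i j S = 0)
    (c : N → V → ℕ → ℝ) (H : ℕ → Finset V → ℝ) (v : ℕ → N → Finset V → ℝ)
    (H0 : ∀ S, H 0 S = 0)
    (hH : ∀ m < n, ∀ S, ∑ i, v (m + 1) i S = n * H (m + 1) S)
    (hL : ∀ m < n, ∀ i S, m + 1 ≤ S.card →
      ∑ j ∈ S, x (m + 1) i j (S.erase j) * (c i j (m + 1) + H m (S.erase j))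
        + y (m + 1) i S * H m S ≤ inflow n x y (m + 1) S / n * v (m + 1) i S) :
    ∑ τ ∈ Icc 1 n, ∑ i : N, ∑ j : V, c i j τ * ∑ S ∈ (univ.erase j).powerset, x τ i j S
      ≤ H n univ := by
  have hn' : (n : ℝ) ≠ 0 := by positivity
  have key : ∀ m ≤ n,
      ∑ τ ∈ Icc 1 m, ∑ i : N, ∑ j : V, c i j τ * ∑ S ∈ (univ.erase j).powerset, x τ i j S
        ≤ ∑ S : Finset V with m ≤ S.card, inflow n x y m S * H m S := by
    intro m
    induction m with
    | zero => intro _; simp [H0]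
    | succ m ih =>
      intro hm
      rw [sum_Icc_succ_top (by omega)]
      have h1 := stage_identity (y := y) hx (fun i j => c i j (m + 1)) (H m) (show m < n by omega)
      have h2 : ∑ S : Finset V with m + 1 ≤ S.card, ∑ i : N,
          (∑ j ∈ S, x (m + 1) i j (S.erase j) * (c i j (m + 1) + H m (S.erase j))
            + y (m + 1) i S * H m S)
          ≤ ∑ S : Finset V with m + 1 ≤ S.card, inflow n x y (m + 1) S * H (m + 1) S := by
        refine sum_le_sum fun S hS => ?_
        refine (sum_le_sum fun i _ => hL m hm i S (by simpa using hS)).trans ?_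
        rw [← mul_sum, hH m hm]
        field_simp
        exact le_rfl
      have h3 := ih (by omega)
      linarith
  refine (key n le_rfl).trans ?_
  simp [inflow, hV]

/-- The flow constraints of the linear program, in terms of the inflow. -/
theorem outflow_le {n : ℕ} (hV : Fintype.card V = n)
    {x : ℕ → N → V → Finset V → ℝ} {y : ℕ → N → Finset V → ℝ} (hxy : PolicyFeasible n x y)
    {t : ℕ} (ht : t ∈ Icc 1 n) (i : N) {S : Finset V} (hS : t ≤ S.card) :
    ∑ j ∈ S, x t i j (S.erase j) + (if t ≠ 1 then y t i S else 0) ≤ inflow n x y t S / n := by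
  rw [mem_Icc] at ht
  rcases ht.2.eq_or_lt with rfl | hlt
  · have hSu : S = univ := by
      rw [← card_eq_iff_eq_univ, hV]
      exact le_antisymm (hV ▸ card_le_univ S) hS
    subst hSu
    have h1 := hxy.initial i
    have h2 : (if t ≠ 1 then y t i univ else 0) ≤ y t i univ := by
      split_ifs
      · exact le_rfl
      · exact hxy.y_nonneg _ _ _
    simp only [inflow, if_true]
    linarith
  · have ht' : t ∈ Icc 1 (n - 1) := by rw [mem_Icc]; omega
    rw [inflow, if_neg hlt.ne, add_div]
    by_cases hSu : S = univ
    · subst hSu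
      have h1 := hxy.flow_univ t ht' i
      have hcard : t < (univ : Finset V).card := by rw [card_univ]; omega
      rw [if_pos hcard]
      simp only [compl_univ, sum_empty, sum_const_zero, zero_div, add_zero]
      rw [div_eq_inv_mul, ← one_div]
      linarith
    · have h1 := hxy.flow t ht' i S (card_pos.1 (by omega)) hSu hS
      rw [div_eq_inv_mul, div_eq_inv_mul, ← one_div]
      linarith

theorem reward_le_of_dominating {n : ℕ} (hn : 0 < n) (hV : Fintype.card V = n)
    {x : ℕ → N → V → Finset V → ℝ} {y : ℕ → N → Finset V → ℝ} (hxy : PolicyFeasible n x y)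
    (c : N → V → ℕ → ℝ) (H : ℕ → Finset V → ℝ) (v : ℕ → N → Finset V → ℝ)
    (H0 : ∀ S, H 0 S = 0) (hv : ∀ m i S, 0 ≤ v (m + 1) i S)
    (hH : ∀ m < n, ∀ S, ∑ i, v (m + 1) i S = n * H (m + 1) S)
    (hdiscard : ∀ m i S, H m S ≤ v (m + 1) i S)
    (hmatch : ∀ m i S, ∀ j ∈ S, c i j (m + 1) + H m (S.erase j) ≤ v (m + 1) i S) :
    ∑ τ ∈ Icc 1 n, ∑ i : N, ∑ j : V, c i j τ * ∑ S ∈ (univ.erase j).powerset, x τ i j S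
      ≤ H n univ := by
  refine reward_le_potential (y := y) hn hV hxy.unreachable c H v H0 hH fun m hm i S hS => ?_
  have h1 := outflow_le hV hxy (show m + 1 ∈ Icc 1 n by rw [mem_Icc]; omega) i hS
  refine le_trans ?_ (mul_le_mul_of_nonneg_right h1 (hv m i S))
  rw [add_mul, sum_mul]
  refine add_le_add (sum_le_sum fun j hj =>
    mul_le_mul_of_nonneg_left (hmatch m i S j hj) (hxy.x_nonneg _ _ _ _)) ?_
  -- In stage 1 the constraints do not bound `y`, but discarding then carries the weight `H 0 = 0`.
  by_cases h : m = 0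
  · subst h; simp [H0]
  · rw [if_pos (by omega)]
    exact mul_le_mul_of_nonneg_left (hdiscard m i S) (hxy.y_nonneg _ _ _)

end Telescoping

/-! ### Actions and modification of a policy in a single state. -/

section Actions

variable {N V : Type*} [DecidableEq V]

/-- The set of available ads after an action: discard (`none`) or match to `j` (`some j`). -/
def next (S : Finset V) : Option V → Finset V
  | none => S
  | some j => S.erase j

/-- The uniform distribution on a set of actions. -/
def unif (K : Finset (Option V)) (a : Option V) : ℝ := if a ∈ K then (K.card : ℝ)⁻¹ else 0

theorem unif_nonneg (K : Finset (Option V)) (a : Option V) : 0 ≤ unif K a := by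
  unfold unif; split_ifs <;> positivity

theorem unif_pos {K : Finset (Option V)} {a : Option V} (ha : a ∈ K) : 0 < unif K a := by
  have : 0 < K.card := card_pos.2 ⟨a, ha⟩
  rw [unif, if_pos ha]
  positivity

/-- The reward of an action: zero for discarding. -/
def actionReward (c : V → ℝ) : Option V → ℝ
  | none => 0
  | some j => c j

/-- A family of sets of actions (for each stage, impression and set of available ads) that describes
the policy choosing among them uniformly at random: some action is allowed, and only available ads
are matched. -/
structure Admissible (K : ℕ → N → Finset V → Finset (Option V)) : Prop where
  nonempty : ∀ τ i S, (K τ i S).Nonempty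
  available : ∀ τ i S j, some j ∈ K τ i S → j ∈ S

variable {K : ℕ → N → Finset V → Finset (Option V)}

variable [DecidableEq N]

/-- The policy `K` with the single action `a` forced for impression `i` in stage `τ` and state `S`. -/
def force (K : ℕ → N → Finset V → Finset (Option V)) (τ : ℕ) (i : N) (S : Finset V)
    (a : Option V) : ℕ → N → Finset V → Finset (Option V) :=
  fun σ k T => if σ = τ ∧ k = i ∧ T = S then {a} else K σ k T

theorem force_subset {τ : ℕ} {i : N} {S : Finset V} {a : Option V} (ha : a ∈ K τ i S) (σ : ℕ)
    (k : N) (T : Finset V) : force K τ i S a σ k T ⊆ K σ k T := by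
  unfold force
  split_ifs with h
  · obtain ⟨rfl, rfl, rfl⟩ := h
    simpa using ha
  · exact Subset.rfl

theorem Admissible.force (hK : Admissible K) {τ : ℕ} {i : N} {S : Finset V} {a : Option V}
    (ha : a ∈ K τ i S) : Admissible (force K τ i S a) where
  nonempty σ k T := by
    unfold OnlineMatching.force
    split_ifs
    · simp
    · exact hK.nonempty _ _ _
  available σ k T j hj := hK.available σ k T j (force_subset ha _ _ _ hj)

end Actions

/-! ### Randomized policies as feasible points, and the effect of forcing one action. -/

section Policies

variable {N V : Type*} [Fintype N] [Fintype V] [DecidableEq V]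

/-- The probability that `S` is the set of available ads after `d` stages. -/
def mass (n : ℕ) (K : ℕ → N → Finset V → Finset (Option V)) : ℕ → Finset V → ℝ
  | 0, S => if S = univ then 1 else 0
  | d + 1, S => ∑ k : N, mass n K d S * unif (K (n - d) k S) none / n
      + ∑ k : N, ∑ j ∈ Sᶜ, mass n K d (insert j S) * unif (K (n - d) k (insert j S)) (some j) / n

def matchProb (n : ℕ) (K : ℕ → N → Finset V → Finset (Option V)) (t : ℕ) (i : N) (j : V)
    (S : Finset V) : ℝ :=
  mass n K (n - t) (insert j S) * unif (K t i (insert j S)) (some j) / n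

def discardProb (n : ℕ) (K : ℕ → N → Finset V → Finset (Option V)) (t : ℕ) (i : N)
    (S : Finset V) : ℝ :=
  mass n K (n - t) S * unif (K t i S) none / n

/-- The matching probabilities of the policy that chooses uniformly from `K`. -/
def policyPoint (n : ℕ) (K : ℕ → N → Finset V → Finset (Option V)) : N → V → Stage n → ℝ :=
  fun i j t => ∑ S ∈ (univ.erase j).powerset, matchProb n K t i j S

variable {n : ℕ} {K : ℕ → N → Finset V → Finset (Option V)}

theorem mass_nonneg (d : ℕ) (S : Finset V) : 0 ≤ mass n K d S := by
  induction d generalizing S with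
  | zero => rw [mass]; split_ifs <;> norm_num
  | succ d ih =>
    rw [mass]
    refine add_nonneg (sum_nonneg fun k _ => ?_) (sum_nonneg fun k _ => sum_nonneg fun j _ => ?_)
    all_goals exact div_nonneg (mul_nonneg (ih _) (unif_nonneg _ _)) (Nat.cast_nonneg _)

theorem mass_eq_zero (hV : Fintype.card V = n) {d : ℕ} {S : Finset V} (h : S.card + d < n) :
    mass n K d S = 0 := by
  induction d generalizing S with
  | zero =>
    rw [mass, if_neg]
    rintro rfl
    rw [card_univ] at h
    omega
  | succ d ih =>
    rw [mass, ih (by omega)]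
    simp only [zero_mul, zero_div, sum_const_zero, zero_add]
    refine sum_eq_zero fun k _ => sum_eq_zero fun j hj => ?_
    rw [ih, zero_mul, zero_div]
    rw [card_insert_of_notMem (mem_compl.1 hj)]
    omega

theorem mass_eq_inflow {t : ℕ} (ht : t < n) (S : Finset V) :
    mass n K (n - t) S = ∑ k : N, discardProb n K (t + 1) k S
      + ∑ k : N, ∑ j ∈ Sᶜ, matchProb n K (t + 1) k j S := by
  obtain ⟨d, rfl⟩ : ∃ d, n = t + 1 + d := ⟨n - (t + 1), by omega⟩
  rw [show t + 1 + d - t = d + 1 by omega, mass]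
  simp only [discardProb, matchProb, show t + 1 + d - (t + 1) = d by omega,
    show t + 1 + d - d = t + 1 by omega]

/-- All allowed actions have the same value, so their average is that value. Taking `F = 1` gives
conservation of probability; taking the Bellman value gives tightness in weak duality. -/
theorem expectation_eq (hK : Admissible K) (t : ℕ) (i : N) (S : Finset V) (F : Option V → ℝ)
    {v : ℝ} (hF : ∀ a ∈ K t i S, F a = v) :
    ∑ j ∈ S, matchProb n K t i j (S.erase j) * F (some j) + discardProb n K t i S * F none
      = mass n K (n - t) S / n * v := by
  have h1 : ∑ a, unif (K t i S) a * F a = v := by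
    have hpos : (0 : ℝ) < (K t i S).card := by exact_mod_cast card_pos.2 (hK.nonempty t i S)
    calc ∑ a, unif (K t i S) a * F a = ∑ a ∈ K t i S, ((K t i S).card : ℝ)⁻¹ * F a := by
          simp only [unif, ite_mul, zero_mul]
          rw [sum_ite_mem, univ_inter]
      _ = ∑ a ∈ K t i S, ((K t i S).card : ℝ)⁻¹ * v :=
          sum_congr rfl fun a ha => by rw [hF a ha]
      _ = v := by rw [sum_const, nsmul_eq_mul]; field_simp
  have h2 : ∑ j ∈ S, unif (K t i S) (some j) * F (some j)
      = ∑ j, unif (K t i S) (some j) * F (some j) := by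
    refine sum_subset (subset_univ _) fun j _ hj => ?_
    rw [unif, if_neg fun h => hj (hK.available t i S j h), zero_mul]
  have h3 : ∑ j ∈ S, matchProb n K t i j (S.erase j) * F (some j)
      = mass n K (n - t) S / n * ∑ j ∈ S, unif (K t i S) (some j) * F (some j) := by
    rw [mul_sum]
    refine sum_congr rfl fun j hj => ?_
    rw [matchProb, insert_erase hj]
    ring
  rw [h3, h2, discardProb, ← h1, Fintype.sum_option]
  ring

theorem outflow_eq (hK : Admissible K) (t : ℕ) (i : N) (S : Finset V) :
    ∑ j ∈ S, matchProb n K t i j (S.erase j) + discardProb n K t i S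
      = mass n K (n - t) S / n := by
  simpa using expectation_eq (n := n) hK t i S (fun _ => 1) (v := 1) (fun _ _ => rfl)

theorem matchProb_nonneg (t : ℕ) (i : N) (j : V) (S : Finset V) : 0 ≤ matchProb n K t i j S :=
  div_nonneg (mul_nonneg (mass_nonneg _ _) (unif_nonneg _ _)) (Nat.cast_nonneg _)

theorem discardProb_nonneg (t : ℕ) (i : N) (S : Finset V) : 0 ≤ discardProb n K t i S :=
  div_nonneg (mul_nonneg (mass_nonneg _ _) (unif_nonneg _ _)) (Nat.cast_nonneg _)

theorem policyFeasible (hV : Fintype.card V = n) (hK : Admissible K) :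
    PolicyFeasible n (matchProb n K) (discardProb n K) where
  x_nonneg := matchProb_nonneg
  y_nonneg := discardProb_nonneg
  unreachable t ht i j S hj hS := by
    rw [mem_Icc] at ht
    rw [matchProb, mass_eq_zero hV, zero_mul, zero_div]
    rw [card_insert_of_notMem hj]
    omega
  initial i := by
    rw [outflow_eq hK, Nat.sub_self, mass, if_pos rfl]
  flow t ht i S _ _ hS := by
    rw [mem_Icc] at ht
    have h1 := outflow_eq (n := n) hK t i S
    rw [mass_eq_inflow (by omega)] at h1
    have h2 : (if t ≠ 1 then discardProb n K t i S else 0) ≤ discardProb n K t i S := by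
      split_ifs
      · exact le_rfl
      · exact discardProb_nonneg _ _ _
    -- If `S.card = t`, the state `S` has probability zero in stage `t + 1`, so the indicator in the
    -- constraint loses nothing.
    have h3 : (if t < S.card then ∑ k : N, discardProb n K (t + 1) k S else 0)
        = ∑ k : N, discardProb n K (t + 1) k S := by
      split_ifs with hlt
      · rfl
      · refine (sum_eq_zero fun k _ => ?_).symm
        rw [discardProb, mass_eq_zero hV (by omega), zero_mul, zero_div]
    rw [h3]
    rw [add_div, div_eq_inv_mul, div_eq_inv_mul, ← one_div] at h1
    linarith
  flow_univ t ht i := by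
    rw [mem_Icc] at ht
    have h1 := outflow_eq (n := n) hK t i univ
    rw [mass_eq_inflow (by omega)] at h1
    have h2 : (if t ≠ 1 then discardProb n K t i univ else 0) ≤ discardProb n K t i univ := by
      split_ifs
      · exact le_rfl
      · exact discardProb_nonneg _ _ _
    simp only [compl_univ, sum_empty, sum_const_zero, add_zero] at h1
    rw [div_eq_inv_mul, ← one_div] at h1
    linarith

theorem policyPoint_mem_achievable (hV : Fintype.card V = n) (hK : Admissible K) :
    policyPoint n K ∈ achievable N V n :=
  ⟨matchProb n K, discardProb n K, policyFeasible hV hK, fun _ _ _ => rfl⟩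

theorem inflow_eq_mass (hV : Fintype.card V = n) {t : ℕ} (ht : t ≤ n) {S : Finset V}
    (hS : t ≤ S.card) :
    inflow n (matchProb n K) (discardProb n K) t S = mass n K (n - t) S := by
  rcases ht.eq_or_lt with rfl | hlt
  · rw [inflow, if_pos rfl, Nat.sub_self, mass]
  · rw [inflow, if_neg hlt.ne, mass_eq_inflow hlt]
    congr 1
    split_ifs with h
    · rfl
    · refine (sum_eq_zero fun k _ => ?_).symm
      rw [discardProb, mass_eq_zero hV (by omega), zero_mul, zero_div]

/-- A policy that uses only actions attaining the optimum collects the value of the potential. -/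
theorem reward_policy_eq (hn : 0 < n) (hV : Fintype.card V = n) (hK : Admissible K)
    (c : N → V → ℕ → ℝ) (H : ℕ → Finset V → ℝ) (v : ℕ → N → Finset V → ℝ)
    (H0 : ∀ S, H 0 S = 0)
    (hH : ∀ m < n, ∀ S, ∑ i, v (m + 1) i S = n * H (m + 1) S)
    (hopt : ∀ m i S, ∀ a ∈ K (m + 1) i S,
      actionReward (fun j => c i j (m + 1)) a + H m (next S a) = v (m + 1) i S) :
    ∑ τ ∈ Icc 1 n, ∑ i : N, ∑ j : V,
        c i j τ * ∑ S ∈ (univ.erase j).powerset, matchProb n K τ i j S = H n univ := by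
  have hL : ∀ m < n, ∀ i S, m + 1 ≤ S.card →
      ∑ j ∈ S, matchProb n K (m + 1) i j (S.erase j) * (c i j (m + 1) + H m (S.erase j))
        + discardProb n K (m + 1) i S * H m S
      = inflow n (matchProb n K) (discardProb n K) (m + 1) S / n * v (m + 1) i S := by
    intro m hm i S hS
    rw [inflow_eq_mass hV hm hS, ← expectation_eq hK (m + 1) i S _ (hopt m i S)]
    simp [actionReward, next]
  have hx := (policyFeasible hV hK).unreachable
  apply le_antisymm
  · exact reward_le_potential hn hV hx c H v H0 hH fun m hm i S hS => (hL m hm i S hS).le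
  -- Weak duality assumes no signs, so it applies to the negated data and gives the reverse
  -- inequality.
  · have := reward_le_potential (y := discardProb n K) hn hV hx (fun i j τ => -c i j τ)
      (fun m S => -H m S) (fun m i S => -v m i S) (fun S => by simp [H0])
      (fun m hm S => by rw [sum_neg_distrib, hH m hm, mul_neg]) (fun m hm i S hS => by
        rw [mul_neg (inflow _ _ _ _ _ / _), ← hL m hm i S hS, neg_add, ← sum_neg_distrib]
        apply le_of_eq
        congr 1
        · exact sum_congr rfl fun j _ => by ring
        · ring)
    simp only [neg_mul, sum_neg_distrib] at this
    linarith

theorem mass_pos_next (hK : Admissible K) (hn : 0 < n) {d : ℕ} {S : Finset V} {i : N}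
    {a : Option V} (hS : 0 < mass n K d S) (ha : a ∈ K (n - d) i S) :
    0 < mass n K (d + 1) (next S a) := by
  have hn' : (0 : ℝ) < n := by exact_mod_cast hn
  have h0 : ∀ (T T' : Finset V) (k : N) (b : Option V),
      0 ≤ mass n K d T * unif (K (n - d) k T') b / n := fun T T' k b =>
    div_nonneg (mul_nonneg (mass_nonneg _ _) (unif_nonneg _ _)) hn'.le
  rw [mass]
  cases a with
  | none =>
    refine add_pos_of_pos_of_nonneg (sum_pos' (fun k _ => h0 _ _ _ _) ⟨i, mem_univ _, ?_⟩)
      (sum_nonneg fun k _ => sum_nonneg fun j _ => h0 _ _ _ _)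
    exact div_pos (mul_pos hS (unif_pos ha)) hn'
  | some j =>
    have hj := hK.available _ _ _ _ ha
    refine add_pos_of_nonneg_of_pos (sum_nonneg fun k _ => h0 _ _ _ _)
      (sum_pos' (fun k _ => sum_nonneg fun j _ => h0 _ _ _ _) ⟨i, mem_univ _, ?_⟩)
    refine sum_pos' (fun j _ => h0 _ _ _ _) ⟨j, by simp [next], ?_⟩
    simp only [next, insert_erase hj]
    exact div_pos (mul_pos hS (unif_pos ha)) hn'

theorem mass_congr {K' : ℕ → N → Finset V → Finset (Option V)} {d : ℕ} (hd : d ≤ n)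
    (h : ∀ τ, n - d < τ → K τ = K' τ) : mass n K d = mass n K' d := by
  induction d with
  | zero => ext S; rfl
  | succ d ih =>
    ext S
    rw [mass, mass, ih (by omega) (fun τ hτ => h τ (by omega)), h (n - d) (by omega)]

variable [DecidableEq N]

theorem mass_force {τ : ℕ} (i : N) (S : Finset V) (a : Option V) {σ : ℕ}
    (hσ : τ ≤ σ) (hσn : σ ≤ n) :
    mass n (force K τ i S a) (n - σ) = mass n K (n - σ) := by
  refine mass_congr (by omega) fun ρ hρ => ?_
  ext k T
  rw [force, if_neg]
  omega

theorem policyPoint_force_of_lt (τ : ℕ) (i : N) (S : Finset V) (a : Option V) (k : N) (j : V)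
    {σ : Stage n} (hσ : τ < σ.1) :
    policyPoint n (force K τ i S a) k j σ = policyPoint n K k j σ := by
  unfold policyPoint matchProb
  rw [mass_force i S a hσ.le (mem_Icc.1 σ.2).2]
  have : force K τ i S a σ = K σ := by
    ext k T
    rw [force, if_neg]
    omega
  rw [this]

/-- The probability of reaching `S` in stage `τ` depends only on decisions in stages above `τ`, so
it is the same for both forced policies. In stages below `τ` the two points may differ in an
uncontrolled way. -/
theorem policyPoint_force_sub (hK : Admissible K) {τ : Stage n} {i : N} {S : Finset V}
    {a b : Option V} (ha : a ∈ K τ i S) (hb : b ∈ K τ i S) (k : N) (j : V) :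
    policyPoint n (force K τ i S a) k j τ - policyPoint n (force K τ i S b) k j τ
      = if k = i then mass n K (n - τ) S / n
          * ((if a = some j then 1 else 0) - (if b = some j then 1 else 0)) else 0 := by
  unfold policyPoint matchProb
  have hτ := (mem_Icc.1 τ.2).2
  rw [mass_force i S a le_rfl hτ, mass_force i S b le_rfl hτ, ← sum_sub_distrib]
  by_cases hj : j ∈ S
  · rw [sum_eq_single (S.erase j)]
    · rw [insert_erase hj]
      simp only [force, true_and, and_true]
      by_cases hk : k = i
      · simp only [hk, if_true, unif, mem_singleton, card_singleton, eq_comm (a := some j)]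
        split_ifs <;> simp
      · simp [hk]
    · intro T hT hTS
      have hjT : j ∉ T := fun h => by simpa using mem_powerset.1 hT h
      have : insert j T ≠ S := by
        rintro rfl
        exact hTS (erase_insert hjT).symm
      simp [force, this]
    · intro h
      exact absurd (mem_powerset.2 (erase_subset_erase _ (subset_univ _))) h
  · have h1 : a ≠ some j := by rintro rfl; exact hj (hK.available _ _ _ _ ha)
    have h2 : b ≠ some j := by rintro rfl; exact hj (hK.available _ _ _ _ hb)
    rw [if_neg h1, if_neg h2, sub_zero, mul_zero, ite_self]
    refine sum_eq_zero fun T _ => ?_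
    have : insert j T ≠ S := by
      rintro rfl
      exact hj (mem_insert_self _ _)
    simp [force, this]

end Policies

/-! ### The explicit dual solution. -/

section Potential

variable {N V : Type*} [DecidableEq V] [DecidableEq N]

/-- The coefficient of `z i j τ` in the inequality. -/
def coeff (n : ℕ) (J : Finset V) (h t : ℕ) (ι : ℕ → N) (i : N) (j : V) (τ : ℕ) : ℝ :=
  if j ∈ J then
    (if t + h ≤ τ then 1 else if t ≤ τ ∧ i = ι τ then (n : ℝ) ^ (t + h - τ) else 0)
  else 0

/-- The term `n ^ l` is the expected reward from reserving an ad for the distinguished impression of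
stage `t + h - 1 - l`: weight `n ^ (l + 1)`, probability `1 / n`. -/
def geomTail (n h a : ℕ) : ℝ := ∑ l ∈ Ico a h, (n : ℝ) ^ l

/-- The maximal expected contribution to the left-hand side of the inequality from stages
`τ, …, 1`, when `S` is the set of available ads. -/
def potential (n : ℕ) (J : Finset V) (h t τ : ℕ) (S : Finset V) : ℝ :=
  geomTail n h (max (h - (S ∩ J).card) (t + h - 1 - τ))

/-- It is strictly better to match impression `i` to some ad of `J` than to discard it. -/
def Urgent (J : Finset V) (h t : ℕ) (ι : ℕ → N) (τ : ℕ) (i : N) (S : Finset V) : Prop :=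
  (t ≤ τ ∧ τ < t + h ∧ h - (S ∩ J).card < t + h - τ) ∧ i = ι τ

instance (J : Finset V) (h t : ℕ) (ι : ℕ → N) (τ : ℕ) (i : N) (S : Finset V) :
    Decidable (Urgent J h t ι τ i S) := by unfold Urgent; infer_instance

/-- The value of the potential in stage `τ`, given that impression `i` appears. -/
def impressionValue (n : ℕ) (J : Finset V) (h t : ℕ) (ι : ℕ → N) (τ : ℕ) (i : N)
    (S : Finset V) : ℝ :=
  potential n J h t (τ - 1) S + if Urgent J h t ι τ i S then (n : ℝ) ^ (t + h - τ) else 0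

theorem geomTail_eq_zero {n h a : ℕ} (ha : h ≤ a) : geomTail n h a = 0 := by
  rw [geomTail, Ico_eq_empty_of_le ha, sum_empty]

theorem geomTail_eq_add {n h a : ℕ} (ha : a < h) :
    geomTail n h a = (n : ℝ) ^ a + geomTail n h (a + 1) := by
  rw [geomTail, sum_eq_sum_Ico_succ_bot ha, geomTail]

theorem geomTail_nonneg (n h a : ℕ) : 0 ≤ geomTail n h a := sum_nonneg fun _ _ => by positivity

variable {n : ℕ} {J : Finset V} {h t : ℕ} {ι : ℕ → N}

theorem potential_zero (ht : 1 ≤ t) (S : Finset V) : potential n J h t 0 S = 0 :=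
  geomTail_eq_zero (le_trans (by omega) (le_max_right _ _))

theorem potential_nonneg (τ : ℕ) (S : Finset V) : 0 ≤ potential n J h t τ S :=
  geomTail_nonneg _ _ _

theorem potential_top [Fintype V] (hJ : J.card = h) (htn : t + h ≤ n) (hh : 1 ≤ h) :
    potential n J h t n univ = 1 + ∑ τ ∈ Icc 1 (h - 1), (n : ℝ) ^ τ := by
  rw [potential, univ_inter, hJ, show max (h - h) (t + h - 1 - n) = 0 by omega,
    geomTail_eq_add (by omega), pow_zero, geomTail]
  congr 1

theorem impressionValue_nonneg (m : ℕ) (i : N) (S : Finset V) :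
    0 ≤ impressionValue n J h t ι m i S := by
  rw [impressionValue]
  refine add_nonneg (potential_nonneg _ _) ?_
  split_ifs <;> positivity

/-- If an ad is reserved for this stage, only the distinguished impression earns the bonus `n ^ (t +
h - τ)`, where `τ = m + 1`. This is `n` times the term `n ^ (t + h - 1 - τ)` that the stage adds to
the potential. Otherwise the stage leaves the potential unchanged. -/
theorem sum_impressionValue [Fintype N] (hN : Fintype.card N = n) (hJ : J.card = h) (m : ℕ)
    (S : Finset V) :
    ∑ i, impressionValue n J h t ι (m + 1) i S = n * potential n J h t (m + 1) S := by
  have hle : (S ∩ J).card ≤ h := hJ ▸ card_le_card inter_subset_right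
  simp only [impressionValue, sum_add_distrib, sum_const, card_univ, hN, nsmul_eq_mul,
    Nat.add_sub_cancel]
  by_cases hc : t ≤ m + 1 ∧ m + 1 < t + h ∧ h - (S ∩ J).card < t + h - (m + 1)
  · simp only [Urgent, hc, true_and, sum_ite_eq', mem_univ, if_true, potential]
    rw [show max (h - (S ∩ J).card) (t + h - 1 - (m + 1)) = t + h - 1 - (m + 1) by omega,
      show max (h - (S ∩ J).card) (t + h - 1 - m) = t + h - 1 - (m + 1) + 1 by omega,
      geomTail_eq_add (show t + h - 1 - (m + 1) < h by omega),
      show t + h - (m + 1) = t + h - 1 - (m + 1) + 1 by omega, pow_succ]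
    ring
  · simp only [Urgent, hc, false_and, if_false, sum_const_zero, add_zero]
    congr 1
    unfold potential
    by_cases h1 : t + h ≤ m + 1
    · congr 1; omega
    · by_cases h2 : m + 1 < t
      · rw [geomTail_eq_zero (by omega), geomTail_eq_zero (by omega)]
      · congr 1; omega

theorem card_erase_inter_of_mem {S : Finset V} {j : V} (hS : j ∈ S) (hj : j ∈ J) :
    (S.erase j ∩ J).card + 1 = (S ∩ J).card := by
  rw [erase_inter]
  exact card_erase_add_one (mem_inter.2 ⟨hS, hj⟩)

theorem potential_erase_of_notMem (m : ℕ) (S : Finset V) {j : V} (hj : j ∉ J) :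
    potential n J h t m (S.erase j) = potential n J h t m S := by
  rw [potential, potential, erase_inter, erase_eq_of_notMem (by simp [hj])]

/-- The loss of potential by using up an ad of `J`. -/
theorem potential_eq_erase_add (hJ : J.card = h) (m : ℕ) {S : Finset V} {j : V} (hS : j ∈ S)
    (hj : j ∈ J) :
    potential n J h t m S = potential n J h t m (S.erase j)
      + if t + h - (m + 1) ≤ h - (S ∩ J).card then (n : ℝ) ^ (h - (S ∩ J).card) else 0 := by
  have hle : (S ∩ J).card ≤ h := hJ ▸ card_le_card inter_subset_right
  have h1 := card_erase_inter_of_mem hS hj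
  unfold potential
  split_ifs with hc
  · rw [show max (h - (S ∩ J).card) (t + h - 1 - m) = h - (S ∩ J).card by omega,
      show max (h - (S.erase j ∩ J).card) (t + h - 1 - m) = h - (S ∩ J).card + 1 by omega,
      geomTail_eq_add (by omega), add_comm]
  · rw [add_zero]
    congr 1
    omega

theorem potential_le_impressionValue (m : ℕ) (i : N) (S : Finset V) :
    potential n J h t m S ≤ impressionValue n J h t ι (m + 1) i S := by
  rw [impressionValue, Nat.add_sub_cancel]
  refine le_add_of_nonneg_right ?_
  split_ifs <;> positivity

/-- Using an ad of `J` costs its least valuable reservation, `n ^ (h - (S ∩ J).card)`, or nothing if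
an ad is to spare. In the urgent case the bonus is exactly the coefficient; for a distinguished
impression that is not urgent, the cost is at least the coefficient because the exponents compare.
From stage `t + h` on, the coefficient is 1, which never exceeds the cost. -/
theorem coeff_add_potential_le (hn : 0 < n) (hJ : J.card = h) (m : ℕ) (i : N) (S : Finset V)
    {j : V} (hS : j ∈ S) :
    coeff n J h t ι i j (m + 1) + potential n J h t m (S.erase j)
      ≤ impressionValue n J h t ι (m + 1) i S := by
  have hn' : (1 : ℝ) ≤ n := by exact_mod_cast hn
  by_cases hj : j ∈ J
  · rw [impressionValue, Nat.add_sub_cancel, potential_eq_erase_add hJ m hS hj, coeff, if_pos hj]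
    have hp : (0 : ℝ) ≤ (n : ℝ) ^ (h - (S ∩ J).card) := by positivity
    have hq : (0 : ℝ) ≤ (n : ℝ) ^ (t + h - (m + 1)) := by positivity
    have hle : (S ∩ J).card ≤ h := hJ ▸ card_le_card inter_subset_right
    have h1 := card_erase_inter_of_mem hS hj
    by_cases h2 : t + h ≤ m + 1
    · have h3 : (1 : ℝ) ≤ (n : ℝ) ^ (h - (S ∩ J).card) := one_le_pow₀ hn'
      have h4 : (0 : ℝ) ≤ if Urgent J h t ι (m + 1) i S then (n : ℝ) ^ (t + h - (m + 1)) else 0 := by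
        split_ifs
        · exact hq
        · exact le_rfl
      rw [if_pos h2, if_pos (by omega)]
      linarith
    · rw [if_neg h2]
      by_cases h5 : t ≤ m + 1 ∧ i = ι (m + 1)
      · rw [if_pos h5]
        by_cases h6 : h - (S ∩ J).card < t + h - (m + 1)
        · rw [if_neg (by omega), if_pos ⟨⟨h5.1, by omega, h6⟩, h5.2⟩]
          linarith
        · rw [if_pos (by omega), if_neg fun hu => h6 hu.1.2.2]
          have h7 : (n : ℝ) ^ (t + h - (m + 1)) ≤ (n : ℝ) ^ (h - (S ∩ J).card) :=
            pow_le_pow_right₀ hn' (by omega)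
          linarith
      · have hu : ¬ Urgent J h t ι (m + 1) i S := fun hu => h5 ⟨hu.1.1, hu.2⟩
        rw [if_neg h5, if_neg hu]
        split_ifs <;> linarith
  · rw [potential_erase_of_notMem m S hj, coeff, if_neg hj, zero_add]
    exact potential_le_impressionValue m i S

end Potential

/-! ### Ties between optimal actions, and reachability of the states where they occur. -/

section OptimalActions

variable {N V : Type*} [Fintype V] [DecidableEq V] [DecidableEq N]

open Classical in
/-- The actions that attain the value of the potential. -/
def optimalActions (n : ℕ) (J : Finset V) (h t : ℕ) (ι : ℕ → N) (τ : ℕ) (i : N) (S : Finset V) :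
    Finset (Option V) :=
  univ.filter fun a => (∀ j, a = some j → j ∈ S) ∧
    actionReward (fun j => coeff n J h t ι i j τ) a + potential n J h t (τ - 1) (next S a)
      = impressionValue n J h t ι τ i S

variable {n : ℕ} {J : Finset V} {h t : ℕ} {ι : ℕ → N} {τ : ℕ} {i : N} {S : Finset V} {j : V}

theorem none_mem_optimalActions (hu : ¬ Urgent J h t ι τ i S) :
    none ∈ optimalActions n J h t ι τ i S := by
  simp [optimalActions, actionReward, next, impressionValue, hu]

theorem some_mem_optimalActions_of_notMem (hu : ¬ Urgent J h t ι τ i S) (hS : j ∈ S)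
    (hj : j ∉ J) : some j ∈ optimalActions n J h t ι τ i S := by
  simp [optimalActions, actionReward, next, impressionValue, hu, hS, coeff, hj,
    potential_erase_of_notMem]

theorem some_mem_optimalActions_of_urgent (hJ : J.card = h) (hu : Urgent J h t ι τ i S)
    (hS : j ∈ S) (hj : j ∈ J) (hτ : 1 ≤ τ) : some j ∈ optimalActions n J h t ι τ i S := by
  obtain ⟨m, rfl⟩ : ∃ m, τ = m + 1 := ⟨τ - 1, by omega⟩
  obtain ⟨⟨h1, h2, h3⟩, h4⟩ := id hu
  simp only [optimalActions, mem_filter, mem_univ, true_and, Option.some.injEq, forall_eq', hS,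
    actionReward, next, impressionValue, hu, if_true, Nat.add_sub_cancel]
  rw [potential_eq_erase_add hJ m hS hj, coeff, if_pos hj, if_neg (by omega), if_pos ⟨h1, h4⟩,
    if_neg (by omega)]
  ring

/-- At a tie, matching the distinguished impression to `J` is as good as discarding it. -/
theorem some_mem_optimalActions_of_tie (hJ : J.card = h) (hi : i = ι τ) (hτ : 1 ≤ τ) (htτ : t ≤ τ)
    (htie : h - (S ∩ J).card = t + h - τ) (hS : j ∈ S) (hj : j ∈ J) :
    some j ∈ optimalActions n J h t ι τ i S := by
  obtain ⟨m, rfl⟩ : ∃ m, τ = m + 1 := ⟨τ - 1, by omega⟩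
  have hu : ¬ Urgent J h t ι (m + 1) i S := fun hu => by have := hu.1.2.2; omega
  simp only [optimalActions, mem_filter, mem_univ, true_and, Option.some.injEq, forall_eq', hS,
    actionReward, next, impressionValue, hu, if_false, Nat.add_sub_cancel, add_zero]
  rw [potential_eq_erase_add hJ m hS hj, coeff, if_pos hj, if_pos htie.ge, htie]
  by_cases h1 : t + h ≤ m + 1
  · rw [if_pos h1, show t + h - (m + 1) = 0 by omega, pow_zero, add_comm]
  · rw [if_neg h1, if_pos ⟨htτ, hi⟩, add_comm]

/-- While all ads are available, an impression that is not distinguished may be matched to `J`. -/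
theorem some_mem_optimalActions_univ (hJ : J.card = h) (hτ : 1 ≤ τ)
    (hi : ¬ (t ≤ τ ∧ τ < t + h ∧ i = ι τ)) (hj : j ∈ J) :
    some j ∈ optimalActions n J h t ι τ i univ := by
  obtain ⟨m, rfl⟩ : ∃ m, τ = m + 1 := ⟨τ - 1, by omega⟩
  have hu : ¬ Urgent J h t ι (m + 1) i univ := fun hu => hi ⟨hu.1.1, hu.1.2.1, hu.2⟩
  simp only [optimalActions, mem_filter, mem_univ, true_and, Option.some.injEq, forall_eq',
    actionReward, next, impressionValue, hu, if_false, Nat.add_sub_cancel, add_zero]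
  rw [potential_eq_erase_add hJ m (mem_univ j) hj, coeff, if_pos hj, univ_inter, hJ, Nat.sub_self,
    pow_zero]
  by_cases h1 : t + h ≤ m + 1
  · rw [if_pos h1, if_pos (by omega), add_comm]
  · rw [if_neg h1, if_neg fun hc => hi ⟨hc.1, by omega, hc.2⟩, if_neg (by omega), add_comm]

theorem admissible_optimalActions (hJ : J.card = h) (ht : 1 ≤ t) :
    Admissible (optimalActions n J h t ι) where
  nonempty τ i S := by
    by_cases hu : Urgent J h t ι τ i S
    · obtain ⟨h1, h2, h3⟩ := hu.1
      -- Urgency means that more than `τ - t` ads of `J` are left.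
      have h4 : 0 < (S ∩ J).card := by omega
      obtain ⟨j, hj⟩ := card_pos.1 h4
      rw [mem_inter] at hj
      exact ⟨_, some_mem_optimalActions_of_urgent hJ hu hj.1 hj.2 (by omega)⟩
    · exact ⟨_, none_mem_optimalActions hu⟩
  available τ i S j hj := by
    simp only [optimalActions, mem_filter] at hj
    exact hj.2.1 j rfl

variable [Fintype N]

/-- As `n ≥ 2`, every stage has an impression that is not distinguished, and discarding it is
optimal. -/
theorem mass_univ_pos (hN : Fintype.card N = n) (hn : 2 ≤ n) (hJ : J.card = h) (ht : 1 ≤ t)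
    (d : ℕ) : 0 < mass n (optimalActions n J h t ι) d univ := by
  induction d with
  | zero => simp [mass]
  | succ d ih =>
    have : Nontrivial N := Fintype.one_lt_card_iff_nontrivial.1 (by omega)
    obtain ⟨i, hi⟩ := exists_ne (ι (n - d))
    exact mass_pos_next (admissible_optimalActions hJ ht) (by omega) ih
      (none_mem_optimalActions (i := i) fun hu => hi hu.2)

/-- The states in which the distinguished impression may be matched to `J` or discarded are reached
with positive probability. -/
theorem mass_pos_of_tie (hN : Fintype.card N = n) (hn : 2 ≤ n) (hJ : J.card = h) (ht : 1 ≤ t)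
    (htn : t + h ≤ n) (k : ℕ) (hk : k ≤ h) (hS : Jᶜ ⊆ S) (hSJ : (S ∩ J).card + k = h) :
    0 < mass n (optimalActions n J h t ι) (n - (t + h - k)) S := by
  induction k generalizing S with
  | zero =>
    have hJS : J ⊆ S := inter_eq_right.1 (eq_of_subset_of_card_le inter_subset_right (by omega))
    have : S = univ := by
      rw [eq_univ_iff_forall]
      intro j
      by_cases hj : j ∈ J
      · exact hJS hj
      · exact hS (mem_compl.2 hj)
    subst this
    exact mass_univ_pos hN hn hJ ht _
  -- Matching to `J` at a tie lowers both the stage and the number of ads of `J` by one, which leads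
  -- to the next tie. The chain starts in stage `t + h` with all ads available.
  | succ k ih =>
    obtain ⟨j, hj, hjS⟩ : ∃ j ∈ J, j ∉ S := by
      by_contra! hcon
      rw [inter_eq_right.2 hcon] at hSJ
      omega
    have hcard : (insert j S ∩ J).card = (S ∩ J).card + 1 := by
      rw [insert_inter_of_mem hj, card_insert_of_notMem (by simp [hjS])]
    have h1 := ih (S := insert j S) (by omega) (hS.trans (subset_insert _ _)) (by omega)
    have h2 : some j ∈ optimalActions n J h t ι (n - (n - (t + h - k))) (ι (t + h - k))
        (insert j S) := by
      rw [show n - (n - (t + h - k)) = t + h - k by omega]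
      exact some_mem_optimalActions_of_tie hJ rfl (by omega) (by omega) (by omega)
        (mem_insert_self _ _) hj
    have h3 := mass_pos_next (admissible_optimalActions hJ ht) (by omega) h1 h2
    rw [next, erase_insert hjS] at h3
    rwa [show n - (t + h - (k + 1)) = n - (t + h - k) + 1 by omega]

end OptimalActions

/-! ### Validity, points of the face, and functionals constant on the face. -/

section Facet

variable {N V : Type*} [Fintype N] [Fintype V] [DecidableEq V] [DecidableEq N]
  {n : ℕ} {J : Finset V} {h t : ℕ} {ι : ℕ → N}

def unitPoint (n : ℕ) (i : N) (j : V) (σ : Stage n) : N → V → Stage n → ℝ :=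
  fun i' j' σ' => if i' = i ∧ j' = j ∧ σ' = σ then 1 else 0

theorem linear_eq_sum_unitPoint (g : (N → V → Stage n → ℝ) →ₗ[ℝ] ℝ) (z : N → V → Stage n → ℝ) :
    g z = ∑ σ, ∑ i, ∑ j, z i j σ * g (unitPoint n i j σ) := by
  have hz : z = ∑ σ, ∑ i, ∑ j, z i j σ • unitPoint n i j σ := by
    ext i j σ
    simp only [Finset.sum_apply, Pi.smul_apply, unitPoint, smul_eq_mul, mul_ite, mul_one, mul_zero,
      ite_and]
    simp
  conv_lhs => rw [hz]
  simp only [map_sum, map_smul, smul_eq_mul]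

theorem jSizeLhs_eq_sum_coeff (z : N → V → Stage n → ℝ) :
    jSizeLhs n J h t (fun τ => ι τ.1) z = ∑ τ : Stage n, ∑ i, ∑ j, coeff n J h t ι i j τ * z i j τ := by
  simp only [jSizeLhs, LinearMap.coe_mk, AddHom.coe_mk, sum_filter, ← sum_add_distrib]
  refine sum_congr rfl fun τ _ => ?_
  have h1 : ∀ i : N, ∑ j, coeff n J h t ι i j τ * z i j τ
      = (if t + h ≤ τ.1 then 1 else if t ≤ τ.1 ∧ i = ι τ then (n : ℝ) ^ (t + h - τ.1) else 0)
        * ∑ j ∈ J, z i j τ := by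
    intro i
    rw [mul_sum, ← sum_subset (subset_univ J) fun j _ hj => by rw [coeff, if_neg hj, zero_mul]]
    exact sum_congr rfl fun j hj => by rw [coeff, if_pos hj]
  simp only [h1, aggr, sum_singleton]
  by_cases h2 : t + h ≤ τ.1
  · simp [h2, not_lt.2 h2]
  · by_cases h3 : t ≤ τ.1
    · simp [h2, h3, not_le.1 h2]
    · simp [h2, h3]

theorem jSizeLhs_projection {z : N → V → Stage n → ℝ} {x : ℕ → N → V → Finset V → ℝ}
    (hz : ∀ i j (τ : Stage n), z i j τ = ∑ S ∈ (univ.erase j).powerset, x τ i j S) :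
    jSizeLhs n J h t (fun τ => ι τ.1) z = ∑ τ ∈ Icc 1 n, ∑ i : N, ∑ j : V,
      coeff n J h t ι i j τ * ∑ S ∈ (univ.erase j).powerset, x τ i j S := by
  rw [jSizeLhs_eq_sum_coeff, ← Finset.sum_coe_sort (Icc 1 n)]
  simp only [hz]

theorem jSizeLhs_le (hN : Fintype.card N = n) (hV : Fintype.card V = n) (hn : 0 < n)
    (hJ : J.card = h) (hh : 1 ≤ h) (ht : 1 ≤ t) (htn : t + h ≤ n) {z : N → V → Stage n → ℝ}
    (hz : z ∈ achievable N V n) :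
    jSizeLhs n J h t (fun τ => ι τ.1) z ≤ 1 + ∑ τ ∈ Icc 1 (h - 1), (n : ℝ) ^ τ := by
  obtain ⟨x, y, hxy, hz⟩ := hz
  rw [jSizeLhs_projection hz, ← potential_top hJ htn hh]
  exact reward_le_of_dominating hn hV hxy _ _ (impressionValue n J h t ι) (potential_zero ht)
    (fun m => impressionValue_nonneg (m + 1)) (fun m _ => sum_impressionValue hN hJ m)
    potential_le_impressionValue (fun m i S j hj => coeff_add_potential_le hn hJ m i S hj)

/-- The points of `achievable N V n` at which the inequality is tight. -/
def face (n : ℕ) (J : Finset V) (h t : ℕ) (ι : ℕ → N) : Set (N → V → Stage n → ℝ) :=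
  {z ∈ achievable N V n |
    jSizeLhs n J h t (fun τ => ι τ.1) z = 1 + ∑ τ ∈ Icc 1 (h - 1), (n : ℝ) ^ τ}

theorem policyPoint_mem_face (hN : Fintype.card N = n) (hV : Fintype.card V = n) (hn : 0 < n)
    (hJ : J.card = h) (hh : 1 ≤ h) (ht : 1 ≤ t) (htn : t + h ≤ n)
    {K : ℕ → N → Finset V → Finset (Option V)} (hK : Admissible K)
    (hopt : ∀ τ i S, K τ i S ⊆ optimalActions n J h t ι τ i S) :
    policyPoint n K ∈ face n J h t ι := by
  refine ⟨policyPoint_mem_achievable hV hK, ?_⟩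
  rw [jSizeLhs_projection (z := policyPoint n K) (x := matchProb n K) fun _ _ _ => rfl,
    ← potential_top hJ htn hh]
  refine reward_policy_eq hn hV hK _ _ (impressionValue n J h t ι) (potential_zero ht)
    (fun m _ => sum_impressionValue hN hJ m) fun m i S a ha => ?_
  have := hopt _ _ _ ha
  simp only [optimalActions, mem_filter] at this
  exact this.2.2

/-- Two optimal actions in a state that is reached with positive probability have the same
coefficient in a functional that is constant on the face and does not see later epochs. -/
theorem actionReward_eq_of_optimal (hN : Fintype.card N = n) (hV : Fintype.card V = n)
    (hn : 0 < n) (hJ : J.card = h) (hh : 1 ≤ h) (ht : 1 ≤ t) (htn : t + h ≤ n)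
    {g : (N → V → Stage n → ℝ) →ₗ[ℝ] ℝ} (hg : ∀ z ∈ face n J h t ι, ∀ w ∈ face n J h t ι, g z = g w)
    {τ : Stage n} (hτ : ∀ σ : Stage n, σ.1 < τ.1 → ∀ i j, g (unitPoint n i j σ) = 0)
    {i : N} {S : Finset V} (hS : 0 < mass n (optimalActions n J h t ι) (n - τ) S)
    {a b : Option V} (ha : a ∈ optimalActions n J h t ι τ i S)
    (hb : b ∈ optimalActions n J h t ι τ i S) :
    actionReward (fun j => g (unitPoint n i j τ)) a
      = actionReward (fun j => g (unitPoint n i j τ)) b := by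
  set K := optimalActions n J h t ι with hKdef
  have hK : Admissible K := admissible_optimalActions hJ ht
  have hmem : ∀ c ∈ K τ i S, policyPoint n (force K τ i S c) ∈ face n J h t ι := fun c hc =>
    policyPoint_mem_face hN hV hn hJ hh ht htn (hK.force hc) (force_subset hc)
  have h1 := hg _ (hmem a ha) _ (hmem b hb)
  rw [← sub_eq_zero, ← map_sub, linear_eq_sum_unitPoint, sum_eq_single τ] at h1
  · simp only [Pi.sub_apply, policyPoint_force_sub hK ha hb] at h1
    rw [sum_eq_single i (fun k _ hk => by simp [hk]) (by simp)] at h1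
    simp only [if_true, mul_assoc, ← mul_sum, sub_mul, ite_mul, one_mul, zero_mul,
      sum_sub_distrib] at h1
    have h2 : ∀ c : Option V, ∑ j, (if c = some j then g (unitPoint n i j τ) else 0)
        = actionReward (fun j => g (unitPoint n i j τ)) c := by
      intro c
      cases c <;> simp [actionReward]
    have hn' : (0 : ℝ) < n := by exact_mod_cast hn
    rw [h2, h2, mul_eq_zero] at h1
    rcases h1 with h1 | h1
    · exact absurd h1 (div_pos hS hn').ne'
    · exact sub_eq_zero.1 h1
  · intro σ _ hσ
    refine sum_eq_zero fun k _ => sum_eq_zero fun j _ => ?_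
    rcases lt_or_gt_of_ne (fun hc => hσ (Subtype.ext hc) : σ.1 ≠ τ.1) with hlt | hlt
    · rw [hτ σ hlt, mul_zero]
    · simp only [Pi.sub_apply]
      rw [policyPoint_force_of_lt _ _ _ _ _ _ hlt, policyPoint_force_of_lt _ _ _ _ _ _ hlt,
        sub_self, zero_mul]
  · simp

/-- A coefficient vanishes as soon as matching and discarding are both optimal in one reachable
state. For an impression that is not distinguished, the state with all ads serves; for a
distinguished one, a tie state does. The exception is `ι t` with `J` in stage `t`, where the
normalization `hg₀` is needed. -/
theorem eq_zero_of_constant_on_face (hN : Fintype.card N = n) (hV : Fintype.card V = n)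
    (hn : 2 ≤ n) (hJ : J.card = h) (hh : 1 ≤ h) (ht : 1 ≤ t) (htn : t + h ≤ n)
    {g : (N → V → Stage n → ℝ) →ₗ[ℝ] ℝ} (hg : ∀ z ∈ face n J h t ι, ∀ w ∈ face n J h t ι, g z = g w)
    {τ₀ : Stage n} (hτ₀ : τ₀.1 = t) {j₀ : V} (hj₀ : j₀ ∈ J)
    (hg₀ : g (unitPoint n (ι t) j₀ τ₀) = 0) : g = 0 := by
  suffices H : ∀ m, ∀ τ : Stage n, τ.1 = m → ∀ i j, g (unitPoint n i j τ) = 0 by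
    refine LinearMap.ext fun z => ?_
    rw [linear_eq_sum_unitPoint]
    simp [fun τ => H _ τ rfl]
  intro m
  induction m using Nat.strong_induction_on with
  | _ m ih =>
  intro τ hτm i j
  have hτ1 := (mem_Icc.1 τ.2).1
  have hτn := (mem_Icc.1 τ.2).2
  have key : ∀ {S : Finset V} {a b : Option V},
      0 < mass n (optimalActions n J h t ι) (n - τ) S →
      a ∈ optimalActions n J h t ι τ i S → b ∈ optimalActions n J h t ι τ i S →
      actionReward (fun j => g (unitPoint n i j τ)) a
        = actionReward (fun j => g (unitPoint n i j τ)) b := fun hS ha hb =>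
    actionReward_eq_of_optimal hN hV (by omega) hJ hh ht htn hg
      (fun σ hσ => ih σ.1 (by omega) σ rfl) hS ha hb
  have hpos := mass_univ_pos (ι := ι) hN hn hJ ht (n - τ)
  by_cases hi : t ≤ τ.1 ∧ τ.1 < t + h ∧ i = ι τ
  · obtain ⟨h1, h2, h3⟩ := hi
    -- A tie in stage `t` would leave no ad of `J`, so there `j` can only be compared with `j₀`.
    by_cases h4 : τ.1 = t ∧ j ∈ J
    · have hu : Urgent J h t ι τ i univ := ⟨⟨h1, h2, by rw [univ_inter, hJ]; omega⟩, h3⟩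
      have h5 := key hpos (some_mem_optimalActions_of_urgent hJ hu (mem_univ j) h4.2 hτ1)
        (some_mem_optimalActions_of_urgent hJ hu (mem_univ j₀) hj₀ hτ1)
      have h6 : τ = τ₀ := Subtype.ext (h4.1.trans hτ₀.symm)
      rw [h4.1] at h3
      simp only [actionReward] at h5
      rw [h5, h3, h6, hg₀]
    -- `T` is the part of a tie state inside `J`: it has `τ - t` ads and must contain `j` if `j ∈
    -- J`, which is possible because then `τ ≠ t`.
    · obtain ⟨T, hTJ, hT, hjT⟩ : ∃ T ⊆ J, T.card = τ.1 - t ∧ (j ∈ J → j ∈ T) := by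
        by_cases hj : j ∈ J
        · obtain ⟨T, hT1, hT2, hT3⟩ := exists_subsuperset_card_eq (s := {j}) (t := J)
            (n := τ.1 - t) (by simpa using hj)
            (by rw [card_singleton]; have : τ.1 ≠ t := fun hc => h4 ⟨hc, hj⟩
                omega) (by omega)
          exact ⟨T, hT2, hT3, fun _ => hT1 (mem_singleton_self j)⟩
        · obtain ⟨T, hT1, hT2⟩ := exists_subset_card_eq (s := J) (n := τ.1 - t) (by omega)
          exact ⟨T, hT1, hT2, fun hc => absurd hc hj⟩
      have hSJ : ((T ∪ Jᶜ) ∩ J) = T := by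
        rw [union_inter_distrib_right, inter_eq_left.2 hTJ, inter_comm Jᶜ, inter_compl,
          union_empty]
      have hjS : j ∈ T ∪ Jᶜ := by
        by_cases hj : j ∈ J
        · exact mem_union_left _ (hjT hj)
        · exact mem_union_right _ (mem_compl.2 hj)
      have htie : h - ((T ∪ Jᶜ) ∩ J).card = t + h - τ := by rw [hSJ, hT]; omega
      have hu : ¬ Urgent J h t ι τ i (T ∪ Jᶜ) := fun hu => by have := hu.1.2.2; omega
      have hmass : 0 < mass n (optimalActions n J h t ι) (n - τ) (T ∪ Jᶜ) := by
        have := mass_pos_of_tie (ι := ι) (S := T ∪ Jᶜ) hN hn hJ ht htn (t + h - τ) (by omega)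
          subset_union_right (by rw [hSJ, hT]; omega)
        rwa [show t + h - (t + h - τ.1) = τ.1 by omega] at this
      refine key hmass (a := some j) ?_ (none_mem_optimalActions hu)
      by_cases hj : j ∈ J
      · exact some_mem_optimalActions_of_tie hJ h3 hτ1 h1 htie hjS hj
      · exact some_mem_optimalActions_of_notMem hu hjS hj
  · have hu : ¬ Urgent J h t ι τ i univ := fun hu => hi ⟨hu.1.1, hu.1.2.1, hu.2⟩
    refine key hpos (a := some j) ?_ (none_mem_optimalActions hu)
    by_cases hj : j ∈ J
    · exact some_mem_optimalActions_univ hJ hτ1 hi hj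
    · exact some_mem_optimalActions_of_notMem hu (mem_univ j) hj

end Facet

/-! ### The dimension count. -/

theorem zero_mem_achievable {N V : Type*} [Fintype N] [Fintype V] [DecidableEq V] {n : ℕ} :
    (0 : N → V → Stage n → ℝ) ∈ achievable N V n :=
  ⟨0, 0, by constructor <;> simp, by simp⟩

/-- A nonempty set on which `f` has a constant nonzero value spans a space of dimension one less
than a set that contains it and the origin, if it spans a space of codimension at most one. -/
theorem finrank_vectorSpan_add_one {E : Type*} [AddCommGroup E] [Module ℝ E]
    [FiniteDimensional ℝ E] {P F : Set E} (hFP : F ⊆ P) (hP : (0 : E) ∈ P) {p : E} (hp : p ∈ F)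
    (f : E →ₗ[ℝ] ℝ) {b : ℝ} (hb : b ≠ 0) (hf : ∀ z ∈ F, f z = b) (e : E)
    (he : ∀ g : E →ₗ[ℝ] ℝ, (∀ z ∈ F, ∀ w ∈ F, g z = g w) → g e = 0 → g = 0) :
    Module.finrank ℝ (vectorSpan ℝ F) + 1 = Module.finrank ℝ (vectorSpan ℝ P) := by
  have hker : vectorSpan ℝ F ≤ LinearMap.ker f := by
    rw [vectorSpan_def, Submodule.span_le]
    rintro _ ⟨z, hz, w, hw, rfl⟩
    simp [hf z hz, hf w hw]
  have hlt : vectorSpan ℝ F < vectorSpan ℝ P := by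
    refine lt_of_le_of_ne (vectorSpan_mono ℝ hFP) fun heq => hb ?_
    have h1 : p -ᵥ (0 : E) ∈ vectorSpan ℝ F := heq ▸ vsub_mem_vectorSpan ℝ (hFP hp) hP
    have h2 := hker h1
    rw [vsub_eq_sub, sub_zero, LinearMap.mem_ker, hf p hp] at h2
    exact h2
  -- Otherwise some nonzero functional vanishes on this sum; it is constant on `F` and kills `e`,
  -- against `he`.
  have htop : vectorSpan ℝ F ⊔ Submodule.span ℝ {e} = ⊤ := by
    by_contra hne
    obtain ⟨g, hg0, hg⟩ := Submodule.exists_le_ker_of_lt_top _ (lt_top_iff_ne_top.2 hne)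
    refine hg0 (he g (fun z hz w hw => ?_) ?_)
    · have h1 := hg (Submodule.mem_sup_left (vsub_mem_vectorSpan ℝ hz hw))
      rwa [LinearMap.mem_ker, vsub_eq_sub, map_sub, sub_eq_zero] at h1
    · exact hg (Submodule.mem_sup_right (Submodule.mem_span_singleton_self e))
  have h1 := Submodule.finrank_lt_finrank_of_lt hlt
  have h2 := Submodule.finrank_add_le_finrank_add_finrank (vectorSpan ℝ F)
    (Submodule.span ℝ {e})
  rw [htop, finrank_top] at h2
  have h3 := Submodule.finrank_le (vectorSpan ℝ P)
  have h4 : Module.finrank ℝ (Submodule.span ℝ {e}) ≤ 1 := by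
    simpa using finrank_span_le_card (R := ℝ) ({e} : Set E)
  omega

end OnlineMatching

end

open OnlineMatching in
theorem mainTheorem4 {N V : Type*} [Fintype N] [Fintype V] [DecidableEq V]
    (n : ℕ) (hN : Fintype.card N = n) (hV : Fintype.card V = n)
    (J : Finset V) (h : ℕ) (hJ : J.card = h) (hh : h ∈ Finset.Icc 1 (n - 1))
    (t : ℕ) (ht : t ∈ Finset.Icc 1 (n - h)) (imp : Stage n → N) :
    IsFacetDefining (achievable N V n) (jSizeLhs n J h t imp)
      (1 + ∑ τ ∈ Finset.Icc 1 (h - 1), (n : ℝ) ^ τ) := by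
  classical
  rw [Finset.mem_Icc] at hh ht
  have htmem : t ∈ Finset.Icc 1 n := by rw [Finset.mem_Icc]; omega
  -- The impressions are extended to all natural numbers; the values outside `1, …, n` are
  -- arbitrary.
  obtain ⟨ι, rfl⟩ : ∃ ι : ℕ → N, imp = fun τ => ι τ.1 :=
    ⟨fun τ => if hτ : τ ∈ Finset.Icc 1 n then imp ⟨τ, hτ⟩ else imp ⟨t, htmem⟩, by
      funext τ; beta_reduce; rw [dif_pos τ.2]⟩
  have htn : t + h ≤ n := by omega
  have hp := policyPoint_mem_face (ι := ι) hN hV (by omega) hJ hh.1 ht.1 htn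
    (admissible_optimalActions hJ ht.1) fun _ _ _ => subset_rfl
  obtain ⟨j₀, hj₀⟩ := Finset.card_pos.1 (show 0 < J.card by omega)
  refine ⟨fun z hz => jSizeLhs_le hN hV (by omega) hJ hh.1 ht.1 htn hz, ⟨_, hp⟩, ?_⟩
  exact finrank_vectorSpan_add_one (Set.sep_subset _ _) zero_mem_achievable hp _
    (by positivity) (fun z hz => hz.2) (unitPoint n (ι t) j₀ ⟨t, htmem⟩) fun g hg hg₀ =>
      eq_zero_of_constant_on_face hN hV (by omega) hJ hh.1 ht.1 htn hg rfl hj₀ hg₀
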